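/- Let $M$ be a closed smooth manifold of dimension $n$ (compact, Hausdorff, without boundary). Choose a finite cover of $M$ by open sets $U_i$ that are domains of smooth charts $\varphi_i : U_i \to \mathbb{R}^n$ onto $\mathbb{R}^n$, and a smooth partition of unity $(\pi_i)$ on $M$ with $\operatorname{supp}(\pi_i)\subset U_i$. For an integer $k \ge 0$ and smooth real-valued functions $f,g$ on $M$ put $$\langle f,g\rangle_{2,k}=\sum_i\sum_{j=0}^{k}\sum_{|I|=j}\int_{\mathbb{R}^n}\partial^I\big((\pi_i f)\circ\varphi_i^{-1}\big)\,\partial^I\big((\pi_i g)\circ\varphi_i^{-1}\big)\,dx ,$$ where $I$ runs over the multi-indices. Let $W^{2,k}(M)$, with norm $\|\cdot\|_{2,k}$, be the Hilbert space completion of $C^\infty(M)$ with respect to $\langle\cdot,\cdot\rangle_{2,k}$, and write $L^2(M)=W^{2,0}(M)$, $\|\cdot\|_2=\|\cdot\|_{2,0}$. Regard elements of $W^{2,2}(M)$ as elements of $L^2(M)$ through the continuous extension $W^{2,2}(M)\to L^2(M)$ of the identity of $C^\infty(M)$. Let $S$ be a linear subspace of $W^{2,2}(M)\subset L^2(M)$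 for which there is a constant $C>0$ such that $\|f\|_{2,2}\le C\,\|f\|_2$ for all $f\in S$. Then $S$ is finite-dimensional. -/

import Mathlib

open scoped Manifold ContDiff
open MeasureTheory

noncomputable section

namespace SobolevManifold

/-- The partial derivative `∂g/∂xᵢ` of a function on `ℝⁿ`. -/
def partialDeriv {n : ℕ} (i : Fin n) (g : EuclideanSpace ℝ (Fin n) → ℝ) :
    EuclideanSpace ℝ (Fin n) → ℝ :=
  fun x => fderiv ℝ g x (EuclideanSpace.single i 1)

/-- The partial derivative `∂ᴵg` with respect to a multi-index `I = (I₀, …, Iₙ₋₁)`, i.e.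
`∂₀^{I₀} ∂₁^{I₁} ⋯ g`. -/
def multiDeriv {n : ℕ} (I : Fin n → ℕ) (g : EuclideanSpace ℝ (Fin n) → ℝ) :
    EuclideanSpace ℝ (Fin n) → ℝ :=
  (List.finRange n).foldr (fun i h => (partialDeriv i)^[I i] h) g

/-- The Sobolev inner product `⟨f, g⟩_{2,k} = ∑_{j ≤ k} ∑_{|I| = j} ∫ ∂ᴵf ∂ᴵg dx` on `ℝⁿ`. -/
def euclideanSobolevInner {n : ℕ} (k : ℕ) (f g : EuclideanSpace ℝ (Fin n) → ℝ) : ℝ :=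
  ∑ j ∈ Finset.range (k + 1), ∑ I ∈ Finset.piAntidiag (Finset.univ : Finset (Fin n)) j,
    ∫ x, multiDeriv I f x * multiDeriv I g x

/-- A cover of the manifold `M` by domains of smooth charts whose image is all of `ℝⁿ`, together
with a smooth partition of unity subordinate to it. (On a compact manifold a locally finite cover
by nonempty sets is finite, so the index type `ι` will be finite; and the closed sets
`tsupport (ρ i)` are compact.) That the domains cover `M` follows from the partition of unity. -/
structure SobolevCover (ι : Type*) (n : ℕ) (M : Type*) [TopologicalSpace M]
    [ChartedSpace (EuclideanSpace ℝ (Fin n)) M] where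
  /-- the charts, identifying open sets `Uᵢ` of `M` with `ℝⁿ` -/
  chart : ι → OpenPartialHomeomorph M (EuclideanSpace ℝ (Fin n))
  chart_mem : ∀ i, chart i ∈ IsManifold.maximalAtlas (𝓡 n) ∞ M
  chart_target : ∀ i, (chart i).target = Set.univ
  /-- the partition of unity -/
  ρ : SmoothPartitionOfUnity ι (𝓡 n) M
  subordinate : ρ.IsSubordinate fun i => (chart i).source

section

variable {ι : Type*} {n : ℕ} {M : Type*} [TopologicalSpace M]
  [ChartedSpace (EuclideanSpace ℝ (Fin n)) M]

/-- The function `ρᵢ f`, which is supported in `Uᵢ`, read as a function on `Uᵢ = ℝⁿ`. -/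
def SobolevCover.localize (D : SobolevCover ι n M) (i : ι) (f : M → ℝ) :
    EuclideanSpace ℝ (Fin n) → ℝ :=
  fun x => D.ρ i ((D.chart i).symm x) * f ((D.chart i).symm x)

/-- The Sobolev inner product `⟨f, g⟩_{2,k} = ∑ᵢ ⟨ρᵢ f, ρᵢ g⟩_{2,k}` on the manifold. -/
def SobolevCover.sobolevInner [Fintype ι] (D : SobolevCover ι n M) (k : ℕ) (f g : M → ℝ) : ℝ :=
  ∑ i, euclideanSobolevInner k (D.localize i f) (D.localize i g)

lemma contDiff_partialDeriv {i : Fin n} {g : EuclideanSpace ℝ (Fin n) → ℝ}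
    (hg : ContDiff ℝ ∞ g) : ContDiff ℝ ∞ (partialDeriv i g) :=
  (hg.fderiv_right (m := ∞) (by simp)).clm_apply contDiff_const

lemma hasCompactSupport_partialDeriv {i : Fin n} {g : EuclideanSpace ℝ (Fin n) → ℝ}
    (hg : HasCompactSupport g) : HasCompactSupport (partialDeriv i g) :=
  hg.fderiv_apply ℝ _

lemma partialDeriv_add {i : Fin n} {g h : EuclideanSpace ℝ (Fin n) → ℝ}
    (hg : ContDiff ℝ ∞ g) (hh : ContDiff ℝ ∞ h) :
    partialDeriv i (g + h) = partialDeriv i g + partialDeriv i h := by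
  funext x
  simp only [partialDeriv, Pi.add_apply]
  rw [fderiv_add (hg.differentiable (by simp) x) (hh.differentiable (by simp) x)]
  rfl

lemma partialDeriv_smul {i : Fin n} {g : EuclideanSpace ℝ (Fin n) → ℝ}
    (hg : ContDiff ℝ ∞ g) (c : ℝ) : partialDeriv i (c • g) = c • partialDeriv i g := by
  funext x
  simp only [partialDeriv, Pi.smul_apply]
  rw [fderiv_const_smul (hg.differentiable (by simp) x)]
  rfl

/-- An auxiliary closure principle for iterated derivatives. -/
lemma multiDeriv_induction {m : ℕ} (I : Fin n → ℕ)
    (P : (Fin m → EuclideanSpace ℝ (Fin n) → ℝ) → Prop)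
    (hP : ∀ i g, P g → P fun a => partialDeriv i (g a))
    (g : Fin m → EuclideanSpace ℝ (Fin n) → ℝ) (hg : P g) : P fun a => multiDeriv I (g a) := by
  unfold multiDeriv
  induction List.finRange n with
  | nil => exact hg
  | cons i l ih =>
    simp only [List.foldr_cons]
    induction I i with
    | zero => exact ih
    | succ r hr =>
      simp only [Function.iterate_succ_apply']
      exact hP i _ hr

lemma contDiff_multiDeriv (I : Fin n → ℕ) {g : EuclideanSpace ℝ (Fin n) → ℝ}
    (hg : ContDiff ℝ ∞ g) : ContDiff ℝ ∞ (multiDeriv I g) :=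
  multiDeriv_induction (m := 1) I (fun g => ContDiff ℝ ∞ (g 0))
    (fun _ _ h => contDiff_partialDeriv h) (fun _ => g) hg

lemma hasCompactSupport_multiDeriv (I : Fin n → ℕ) {g : EuclideanSpace ℝ (Fin n) → ℝ}
    (hg : HasCompactSupport g) : HasCompactSupport (multiDeriv I g) :=
  multiDeriv_induction (m := 1) I (fun g => HasCompactSupport (g 0))
    (fun _ _ h => hasCompactSupport_partialDeriv h) (fun _ => g) hg

lemma multiDeriv_add (I : Fin n → ℕ) {g h : EuclideanSpace ℝ (Fin n) → ℝ}
    (hg : ContDiff ℝ ∞ g) (hh : ContDiff ℝ ∞ h) :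
    multiDeriv I (g + h) = multiDeriv I g + multiDeriv I h :=
  (multiDeriv_induction (m := 3) I
    (fun u => ContDiff ℝ ∞ (u 0) ∧ ContDiff ℝ ∞ (u 1) ∧ u 2 = u 0 + u 1)
    (fun _ _ h => ⟨contDiff_partialDeriv h.1, contDiff_partialDeriv h.2.1,
      by simp only [h.2.2, partialDeriv_add h.1 h.2.1]⟩) ![g, h, g + h] ⟨hg, hh, rfl⟩).2.2

lemma multiDeriv_smul (I : Fin n → ℕ) {g : EuclideanSpace ℝ (Fin n) → ℝ}
    (hg : ContDiff ℝ ∞ g) (c : ℝ) : multiDeriv I (c • g) = c • multiDeriv I g :=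
  (multiDeriv_induction (m := 2) I (fun u => ContDiff ℝ ∞ (u 0) ∧ u 1 = c • u 0)
    (fun _ _ h => ⟨contDiff_partialDeriv h.1, by simp only [h.2, partialDeriv_smul h.1]⟩)
    ![g, c • g] ⟨hg, rfl⟩).2

lemma integrable_multiDeriv_mul (I : Fin n → ℕ) {g h : EuclideanSpace ℝ (Fin n) → ℝ}
    (hg : ContDiff ℝ ∞ g) (hh : ContDiff ℝ ∞ h) (hc : HasCompactSupport g) :
    Integrable fun x => multiDeriv I g x * multiDeriv I h x :=
  ((contDiff_multiDeriv I hg).continuous.mul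
    (contDiff_multiDeriv I hh).continuous).integrable_of_hasCompactSupport
      (hasCompactSupport_multiDeriv I hc).mul_right

lemma SobolevCover.contDiff_localize (D : SobolevCover ι n M)
    (i : ι) {f : M → ℝ} (hf : ContMDiff (𝓡 n) 𝓘(ℝ, ℝ) ∞ f) : ContDiff ℝ ∞ (D.localize i f) := by
  have hs : ContMDiff (𝓡 n) (𝓡 n) ∞ (D.chart i).symm := by
    rw [← contMDiffOn_univ, ← D.chart_target i]
    exact contMDiffOn_symm_of_mem_maximalAtlas (D.chart_mem i)
  have h1 : ContDiff ℝ ∞ fun x => D.ρ i ((D.chart i).symm x) :=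
    ((D.ρ i).contMDiff.comp hs).contDiff
  have h2 : ContDiff ℝ ∞ fun x => f ((D.chart i).symm x) := (hf.comp hs).contDiff
  exact h1.mul h2

lemma SobolevCover.hasCompactSupport_localize [CompactSpace M] (D : SobolevCover ι n M) (i : ι)
    (f : M → ℝ) : HasCompactSupport (D.localize i f) := by
  have hK : IsCompact (D.chart i '' tsupport (D.ρ i)) :=
    (isClosed_tsupport _).isCompact.image_of_continuousOn
      ((D.chart i).continuousOn.mono (D.subordinate i))
  refine HasCompactSupport.intro hK fun x hx => ?_
  have hx' : (D.chart i).symm x ∉ tsupport (D.ρ i) := fun h =>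
    hx ⟨_, h, (D.chart i).right_inv (by rw [D.chart_target i]; trivial)⟩
  simp [SobolevCover.localize, image_eq_zero_of_notMem_tsupport hx']

lemma euclideanSobolevInner_self_nonneg (k : ℕ) (f : EuclideanSpace ℝ (Fin n) → ℝ) :
    0 ≤ euclideanSobolevInner k f f :=
  Finset.sum_nonneg fun _ _ => Finset.sum_nonneg fun _ _ =>
    integral_nonneg fun _ => mul_self_nonneg _

lemma euclideanSobolevInner_zero_le (k : ℕ) (f : EuclideanSpace ℝ (Fin n) → ℝ) :
    euclideanSobolevInner 0 f f ≤ euclideanSobolevInner k f f :=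
  Finset.sum_le_sum_of_subset_of_nonneg (Finset.range_mono (by omega))
    fun _ _ _ => Finset.sum_nonneg fun _ _ => integral_nonneg fun _ => mul_self_nonneg _

/-- The space `C^∞(M)` of smooth real functions on `M`; all of them have compact support when `M`
is compact. The arguments `D` and `k` select the inner product `⟨ , ⟩_{2,k}` that it carries. -/
def SmoothFun (_D : SobolevCover ι n M) (_k : ℕ) : Type _ := C^∞⟮𝓡 n, M; 𝓘(ℝ, ℝ), ℝ⟯

variable (D : SobolevCover ι n M) (k : ℕ)

instance : AddCommGroup (SmoothFun D k) :=
  inferInstanceAs (AddCommGroup C^∞⟮𝓡 n, M; 𝓘(ℝ, ℝ), ℝ⟯)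

instance : Module ℝ (SmoothFun D k) :=
  inferInstanceAs (Module ℝ C^∞⟮𝓡 n, M; 𝓘(ℝ, ℝ), ℝ⟯)

/-- The underlying function of a smooth function. -/
def SmoothFun.toFun {D : SobolevCover ι n M} {k : ℕ} (f : SmoothFun D k) : M → ℝ :=
  DFunLike.coe (F := C^∞⟮𝓡 n, M; 𝓘(ℝ, ℝ), ℝ⟯) f

lemma SmoothFun.contMDiff {D : SobolevCover ι n M} {k : ℕ} (f : SmoothFun D k) :
    ContMDiff (𝓡 n) 𝓘(ℝ, ℝ) ∞ f.toFun :=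
  ContMDiffMap.contMDiff (n := ∞) (I := 𝓡 n) (I' := 𝓘(ℝ, ℝ)) (M := M) (M' := ℝ) f

variable [Fintype ι] [CompactSpace M]

/-- The inner product `⟨ , ⟩_{2,k}` on `C^∞(M)`. (It is definite, but the completion does not need
this.) -/
abbrev sobolevCore : PreInnerProductSpace.Core ℝ (SmoothFun D k) where
  inner f g := D.sobolevInner k f.toFun g.toFun
  conj_inner_symm f g := by
    simp only [SobolevCover.sobolevInner, euclideanSobolevInner, conj_trivial]
    simp only [mul_comm]
  re_inner_nonneg f := Finset.sum_nonneg fun _ _ => euclideanSobolevInner_self_nonneg k _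
  add_left f g h := by
    have hl : ∀ i, D.localize i (f + g).toFun = D.localize i f.toFun + D.localize i g.toFun :=
      fun i => funext fun x => mul_add _ _ _
    simp only [SobolevCover.sobolevInner, euclideanSobolevInner, ← Finset.sum_add_distrib]
    refine Finset.sum_congr rfl fun i _ => Finset.sum_congr rfl fun j _ =>
      Finset.sum_congr rfl fun I _ => ?_
    have hf := D.contDiff_localize i f.contMDiff
    have hg := D.contDiff_localize i g.contMDiff
    have hh := D.contDiff_localize i h.contMDiff
    rw [hl, multiDeriv_add I hf hg, ← integral_add
      (integrable_multiDeriv_mul I hf hh (D.hasCompactSupport_localize i _))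
      (integrable_multiDeriv_mul I hg hh (D.hasCompactSupport_localize i _))]
    simp only [Pi.add_apply, add_mul]
  smul_left f g c := by
    have hl : ∀ i, D.localize i (c • f).toFun = c • D.localize i f.toFun :=
      fun i => funext fun x => mul_left_comm _ _ _
    simp only [SobolevCover.sobolevInner, euclideanSobolevInner, Finset.mul_sum, conj_trivial]
    refine Finset.sum_congr rfl fun i _ => Finset.sum_congr rfl fun j _ =>
      Finset.sum_congr rfl fun I _ => ?_
    rw [hl, multiDeriv_smul I (D.contDiff_localize i f.contMDiff), ← integral_const_mul]
    simp only [Pi.smul_apply, smul_eq_mul, mul_assoc]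

/-- `C^∞(M)` with the norm `‖f‖_{2,k} = √⟨f, f⟩_{2,k}`. -/
instance : SeminormedAddCommGroup (SmoothFun D k) :=
  @InnerProductSpace.Core.toSeminormedAddCommGroup ℝ (SmoothFun D k) _ _ _ (sobolevCore D k)

instance : InnerProductSpace ℝ (SmoothFun D k) := InnerProductSpace.ofCore (sobolevCore D k)

/-- The Sobolev space `W^{2,k}(M)`: the Hilbert space completion of `C^∞(M)` with respect to the
Sobolev inner product `⟨ , ⟩_{2,k}`. -/
abbrev SobolevSpace : Type _ := UniformSpace.Completion (SmoothFun D k)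

/-- `L²(M)`, i.e. the completion `W^{2,0}(M)` of `C^∞(M)` with respect to `⟨ , ⟩_{2,0}`. -/
abbrev L2 : Type _ := SobolevSpace D 0

lemma norm_sq_smoothFun (f : SmoothFun D k) : ‖f‖ ^ 2 = D.sobolevInner k f.toFun f.toFun :=
  (real_inner_self_eq_norm_sq f).symm

/-- The identity `(C^∞(M), ‖ ‖_{2,k}) → (C^∞(M), ‖ ‖_{2,0})`, which is continuous. -/
def smoothToL2 : SmoothFun D k →L[ℝ] SmoothFun D 0 :=
  LinearMap.mkContinuous
    { toFun := fun f => f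
      map_add' := fun _ _ => rfl
      map_smul' := fun _ _ => rfl } 1 fun f => by
    rw [one_mul]
    refine le_of_sq_le_sq ?_ (norm_nonneg _)
    rw [norm_sq_smoothFun, norm_sq_smoothFun]
    exact Finset.sum_le_sum fun i _ => euclideanSobolevInner_zero_le k _

/-- The inclusion `W^{2,k}(M) ⊂ L²(M)`: the continuous extension of the identity of `C^∞(M)`. -/
def toL2 : SobolevSpace D k →L[ℝ] L2 D := (smoothToL2 D k).completion

end

end SobolevManifold

end

namespace SobolevManifold

/-! The inclusion of the Sobolev space into `L²` is, up to an arbitrarily small multiple of the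
Sobolev norm, controlled by finitely many continuous functionals. This quantitative form of
Rellich's theorem replaces any extraction of convergent sequences.

The functionals are the integrals of the localized functions over a grid of cubes of side `h`
(`cubeIntegral`). On one cube, the variance identity turns the `L²` distance of `u` from its mean
into a double integral of `(u x - u y) ^ 2`. Differences of points of a cube lie in a cube of side
`2h`, and translating by such a `z` changes `u` in `L²` by at most the norm of its derivative along
`z`. Summation over the grid gives the Poincaré inequality `integral_sq_le_sum_cube`, with an error
of order `h²` times the Dirichlet energy.

Summing over the charts and passing to the completion by density yields `norm_sq_toL2_le`. If `f` in
`S` is killed by all the functionals, then `‖f‖² ≤ C² a h² ‖f‖²` with `a = 2 ^ n * n ^ 2`. For small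
`h` this forces `f = 0`, so `S` embeds in a finite-dimensional space. -/

lemma sub_sq_eq_quadratic {α : Type*} (f : α → ℝ) (x : α) :
    (fun y => (f x - f y) ^ 2) = fun y => 1 * f y ^ 2 - 2 * f x * f y + f x ^ 2 := by
  ext y
  ring

/-! ### Variance as a double integral -/

section Variance

variable {α : Type*} [MeasurableSpace α] {μ : Measure α} [IsFiniteMeasure μ] {f : α → ℝ}

/-- One shape serves both levels of the double integral: the inner integrand has `a = 1`, the outer
one has the total mass as `a`. -/
lemma integrable_quadratic (hf : Integrable f μ) (hf2 : Integrable (fun x => f x ^ 2) μ)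
    (a b c : ℝ) : Integrable (fun x => a * f x ^ 2 - b * f x + c) μ :=
  ((hf2.const_mul a).sub (hf.const_mul b)).add (integrable_const c)

lemma integral_quadratic (hf : Integrable f μ) (hf2 : Integrable (fun x => f x ^ 2) μ)
    (a b c : ℝ) : ∫ x, (a * f x ^ 2 - b * f x + c) ∂μ
      = a * ∫ x, f x ^ 2 ∂μ - b * ∫ x, f x ∂μ + μ.real Set.univ * c := by
  have h1 : Integrable (fun x => a * f x ^ 2 - b * f x) μ :=
    (hf2.const_mul a).sub (hf.const_mul b)
  rw [integral_add h1 (integrable_const c), integral_sub (hf2.const_mul a) (hf.const_mul b),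
    integral_const, integral_const_mul, integral_const_mul, smul_eq_mul]

lemma integral_sub_sq (hf : Integrable f μ) (hf2 : Integrable (fun x => f x ^ 2) μ) :
    (fun x => ∫ y, (f x - f y) ^ 2 ∂μ) = fun x =>
      μ.real Set.univ * f x ^ 2 - 2 * (∫ y, f y ∂μ) * f x + ∫ y, f y ^ 2 ∂μ := by
  ext x
  rw [sub_sq_eq_quadratic, integral_quadratic hf hf2]
  ring

lemma integral_integral_sub_sq (hf : Integrable f μ) (hf2 : Integrable (fun x => f x ^ 2) μ) :
    ∫ x, ∫ y, (f x - f y) ^ 2 ∂μ ∂μ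
      = 2 * (μ.real Set.univ * ∫ x, f x ^ 2 ∂μ - (∫ x, f x ∂μ) ^ 2) := by
  rw [integral_sub_sq hf hf2, integral_quadratic hf hf2]
  ring

/-- Cauchy–Schwarz against the constant `1`, read off from the nonnegativity of the double integral.
-/
lemma sq_integral_le (hf : Integrable f μ) (hf2 : Integrable (fun x => f x ^ 2) μ) :
    (∫ x, f x ∂μ) ^ 2 ≤ μ.real Set.univ * ∫ x, f x ^ 2 ∂μ := by
  have h := integral_integral_sub_sq hf hf2
  have h0 : 0 ≤ ∫ x, ∫ y, (f x - f y) ^ 2 ∂μ ∂μ :=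
    integral_nonneg fun x => integral_nonneg fun y => sq_nonneg _
  linarith

/-- The extended nonnegative form lets the later exchanges of integrals rest on Tonelli, with no
integrability to check. -/
lemma lintegral_lintegral_sub_sq (hf : Integrable f μ) (hf2 : Integrable (fun x => f x ^ 2) μ) :
    ∫⁻ x, ∫⁻ y, ENNReal.ofReal ((f x - f y) ^ 2) ∂μ ∂μ
      = ENNReal.ofReal (2 * (μ.real Set.univ * ∫ x, f x ^ 2 ∂μ - (∫ x, f x ∂μ) ^ 2)) := by
  have hi : ∀ x, Integrable (fun y => (f x - f y) ^ 2) μ := fun x => by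
    rw [sub_sq_eq_quadratic]
    exact integrable_quadratic hf hf2 _ _ _
  have hi' : Integrable (fun x => ∫ y, (f x - f y) ^ 2 ∂μ) μ := by
    rw [integral_sub_sq hf hf2]
    exact integrable_quadratic hf hf2 _ _ _
  rw [← integral_integral_sub_sq hf hf2, ofReal_integral_eq_lintegral_ofReal hi'
    (.of_forall fun x => integral_nonneg fun y => sq_nonneg _)]
  refine lintegral_congr fun x => ?_
  rw [ofReal_integral_eq_lintegral_ofReal (hi x) (.of_forall fun y => sq_nonneg _)]

end Variance

/-! ### Translation estimate in `L²` -/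

lemma ofReal_sub_sq_le_lintegral {E : Type*} [NormedAddCommGroup E] [NormedSpace ℝ E]
    {u : E → ℝ} (hu : ContDiff ℝ 1 u) (x z : E) :
    ENNReal.ofReal ((u (x + z) - u x) ^ 2)
      ≤ ∫⁻ t in Set.Ioc (0 : ℝ) 1, ENNReal.ofReal (fderiv ℝ u (x + t • z) z ^ 2) := by
  have hc : Continuous fun t : ℝ => fderiv ℝ u (x + t • z) z :=
    ((hu.continuous_fderiv (by simp)).comp (by fun_prop)).clm_apply continuous_const
  have hd : ∀ t : ℝ, HasDerivAt (fun t : ℝ => u (x + t • z)) (fderiv ℝ u (x + t • z) z) t := by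
    intro t
    have h1 : HasDerivAt (fun t : ℝ => x + t • z) z t := by
      simpa using ((hasDerivAt_id t).smul_const z).const_add x
    exact ((hu.differentiable (by simp) _).hasFDerivAt).comp_hasDerivAt t h1
  have h := intervalIntegral.integral_eq_sub_of_hasDerivAt (fun t _ => hd t)
    (hc.intervalIntegrable 0 1)
  simp only [one_smul, zero_smul, add_zero] at h
  rw [← h, intervalIntegral.integral_of_le zero_le_one]
  have hi := (hc.intervalIntegrable (μ := volume) 0 1).1
  have hi2 : IntegrableOn (fun t : ℝ => fderiv ℝ u (x + t • z) z ^ 2) (Set.Ioc 0 1) :=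
    ((hc.pow 2).intervalIntegrable 0 1).1
  rw [← ofReal_integral_eq_lintegral_ofReal hi2 (.of_forall fun t => sq_nonneg _)]
  -- The increment is the integral of the derivative along the segment; Cauchy–Schwarz costs no
  -- constant because the interval has length one.
  refine ENNReal.ofReal_le_ofReal ((sq_integral_le hi hi2).trans_eq ?_)
  simp

/-- The `L²` modulus of continuity of a `C¹` function is controlled by its gradient. -/
lemma lintegral_translate_sub_sq_le {E : Type*} [NormedAddCommGroup E] [NormedSpace ℝ E]
    [FiniteDimensional ℝ E] [MeasurableSpace E] [BorelSpace E] (μ : Measure E) [μ.IsAddHaarMeasure]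
    {u : E → ℝ} (hu : ContDiff ℝ 1 u) (z : E) :
    ∫⁻ x, ENNReal.ofReal ((u (x + z) - u x) ^ 2) ∂μ
      ≤ ∫⁻ x, ENNReal.ofReal (fderiv ℝ u x z ^ 2) ∂μ := by
  have hc : Continuous fun p : E × ℝ => fderiv ℝ u (p.1 + p.2 • z) z :=
    ((hu.continuous_fderiv (by simp)).comp (by fun_prop)).clm_apply continuous_const
  calc ∫⁻ x, ENNReal.ofReal ((u (x + z) - u x) ^ 2) ∂μ
      ≤ ∫⁻ x, (∫⁻ t in Set.Ioc (0 : ℝ) 1, ENNReal.ofReal (fderiv ℝ u (x + t • z) z ^ 2)) ∂μ :=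
        lintegral_mono fun x => ofReal_sub_sq_le_lintegral hu x z
    _ = ∫⁻ t in Set.Ioc (0 : ℝ) 1, ∫⁻ x, ENNReal.ofReal (fderiv ℝ u (x + t • z) z ^ 2) ∂μ :=
        lintegral_lintegral_swap (f := fun x t => ENNReal.ofReal (fderiv ℝ u (x + t • z) z ^ 2))
          (ENNReal.continuous_ofReal.comp (hc.pow 2)).measurable.aemeasurable
    -- Translation invariance of `μ` removes `t` from the inner integral.
    _ = ∫⁻ t in Set.Ioc (0 : ℝ) 1, ∫⁻ x, ENNReal.ofReal (fderiv ℝ u x z ^ 2) ∂μ := by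
        refine lintegral_congr fun t => ?_
        exact lintegral_add_right_eq_self (fun x => ENNReal.ofReal (fderiv ℝ u x z ^ 2)) (t • z)
    _ = _ := by simp

/-! ### Grids of cubes -/

/-- The half-open cube of side `h` with index `k ∈ ℤⁿ`. -/
def cube {n : ℕ} (h : ℝ) (k : Fin n → ℤ) : Set (EuclideanSpace ℝ (Fin n)) :=
  {x | ∀ i, ⌊x i / h⌋ = k i}

variable {n : ℕ} {h : ℝ}

/-- The floor description makes disjointness and covering immediate; this product description
supplies measurability and volume. -/
lemma cube_eq_preimage (hh : 0 < h) (k : Fin n → ℤ) :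
    cube h k = WithLp.ofLp ⁻¹'
      (Set.univ.pi fun i => Set.Ico (h * k i) (h * k i + h) : Set (Fin n → ℝ)) := by
  ext x
  simp only [cube, Set.mem_ofPred_eq, Set.mem_preimage, Set.mem_pi, Set.mem_univ, true_imp_iff,
    Set.mem_Ico, Int.floor_eq_iff, le_div_iff₀ hh, div_lt_iff₀ hh]
  refine forall_congr' fun i => ?_
  rw [mul_comm h, add_mul, one_mul]

lemma measurableSet_cube (hh : 0 < h) (k : Fin n → ℤ) : MeasurableSet (cube h k) := by
  rw [cube_eq_preimage hh]
  exact (PiLp.volume_preserving_ofLp (Fin n)).measurable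
    (MeasurableSet.univ_pi fun _ => measurableSet_Ico)

lemma volume_cube (hh : 0 < h) (k : Fin n → ℤ) :
    volume (cube h k) = ENNReal.ofReal (h ^ n) := by
  rw [cube_eq_preimage hh, (PiLp.volume_preserving_ofLp (Fin n)).measure_preimage
    (MeasurableSet.univ_pi fun _ => measurableSet_Ico).nullMeasurableSet, Real.volume_pi_Ico]
  simp [ENNReal.ofReal_pow hh.le]

lemma pairwiseDisjoint_cube (s : Set (Fin n → ℤ)) : s.PairwiseDisjoint (cube h) := by
  intro k _ l _ hkl
  refine Set.disjoint_left.2 fun x hx hx' => hkl (funext fun i => ?_)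
  rw [← hx i, hx' i]

/-- The cube centred at the origin that contains all differences of points of a cube of
side `h`. -/
def differenceCube (n : ℕ) (h : ℝ) : Set (EuclideanSpace ℝ (Fin n)) :=
  {z | ∀ i, |z i| ≤ h}

lemma differenceCube_eq_preimage :
    differenceCube n h = WithLp.ofLp ⁻¹' (Set.Icc (fun _ => -h) (fun _ => h) : Set (Fin n → ℝ)) := by
  ext x
  simp [differenceCube, abs_le, Pi.le_def, forall_and]

lemma measurableSet_differenceCube : MeasurableSet (differenceCube n h) := by
  rw [differenceCube_eq_preimage]
  exact (PiLp.volume_preserving_ofLp (Fin n)).measurable measurableSet_Icc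

lemma volume_differenceCube (hh : 0 < h) :
    volume (differenceCube n h) = ENNReal.ofReal ((2 * h) ^ n) := by
  rw [differenceCube_eq_preimage, (PiLp.volume_preserving_ofLp (Fin n)).measure_preimage
    measurableSet_Icc.nullMeasurableSet, Real.volume_Icc_pi]
  simp [← two_mul, ENNReal.ofReal_pow (by positivity : 0 ≤ 2 * h)]

lemma sub_mem_differenceCube (hh : 0 < h) {k : Fin n → ℤ} {x y : EuclideanSpace ℝ (Fin n)}
    (hx : x ∈ cube h k) (hy : y ∈ cube h k) : y - x ∈ differenceCube n h := by
  intro i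
  rw [cube_eq_preimage hh] at hx hy
  have h1 := hx i trivial
  have h2 := hy i trivial
  simp only [Set.mem_Ico] at h1 h2
  rw [PiLp.sub_apply, abs_le]
  constructor <;> linarith

lemma exists_finset_cover_cube {K : Set (EuclideanSpace ℝ (Fin n))} (hK : Bornology.IsBounded K)
    (hh : 0 < h) : ∃ s : Finset (Fin n → ℤ), K ⊆ ⋃ k ∈ s, cube h k := by
  obtain ⟨R, hR⟩ := hK.exists_norm_le
  refine ⟨Finset.Icc (fun _ => ⌊-R / h⌋) (fun _ => ⌊R / h⌋), fun x hx => ?_⟩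
  simp only [Set.mem_iUnion]
  refine ⟨fun i => ⌊x i / h⌋, ?_, fun i => rfl⟩
  have hb : ∀ i, |x i| ≤ R := fun i => (PiLp.norm_apply_le x i).trans (hR x hx)
  rw [Finset.mem_Icc]
  exact ⟨fun i => Int.floor_mono (by have := (abs_le.1 (hb i)).1; gcongr),
    fun i => Int.floor_mono (by have := (abs_le.1 (hb i)).2; gcongr)⟩

/-! ### Poincaré inequality on a grid -/

lemma fderiv_apply_sq_le (u : EuclideanSpace ℝ (Fin n) → ℝ) (x : EuclideanSpace ℝ (Fin n))
    {z : EuclideanSpace ℝ (Fin n)} (hz : z ∈ differenceCube n h) :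
    fderiv ℝ u x z ^ 2 ≤ n * h ^ 2 * ∑ i, partialDeriv i u x ^ 2 := by
  have hs : z = ∑ i, z i • EuclideanSpace.single i (1 : ℝ) := by
    simpa using ((EuclideanSpace.basisFun (Fin n) ℝ).sum_repr z).symm
  have hs' : fderiv ℝ u x z = ∑ i, z i * partialDeriv i u x := by
    conv_lhs => rw [hs]
    simp [partialDeriv]
  rw [hs']
  refine (Finset.sum_mul_sq_le_sq_mul_sq _ _ _).trans ?_
  gcongr
  calc ∑ i, z i ^ 2 ≤ ∑ _i : Fin n, h ^ 2 :=
        Finset.sum_le_sum fun i _ => sq_le_sq' (abs_le.1 (hz i)).1 (abs_le.1 (hz i)).2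
    _ = n * h ^ 2 := by simp

/-- Substitute `z = y - x` and enlarge the domain. The new domain depends neither on `x` nor on the
cube, so the outer integrals over the cubes can then be merged into one. -/
lemma setLIntegral_cube_sub_sq_le (hh : 0 < h) (u : EuclideanSpace ℝ (Fin n) → ℝ) {k : Fin n → ℤ}
    {x : EuclideanSpace ℝ (Fin n)} (hx : x ∈ cube h k) :
    ∫⁻ y in cube h k, ENNReal.ofReal ((u x - u y) ^ 2)
      ≤ ∫⁻ z in differenceCube n h, ENNReal.ofReal ((u (x + z) - u x) ^ 2) := by
  rw [← lintegral_indicator measurableSet_differenceCube,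
    ← lintegral_indicator (measurableSet_cube hh k),
    ← lintegral_sub_right_eq_self ((differenceCube n h).indicator _) x]
  refine lintegral_mono fun y => ?_
  by_cases hy : y ∈ cube h k
  · rw [Set.indicator_of_mem hy, Set.indicator_of_mem (sub_mem_differenceCube hh hx hy),
      add_sub_cancel, sub_sq_comm]
  · rw [Set.indicator_of_notMem hy]
    exact zero_le

/-- The Dirichlet energy `∫ |∇u|²`. -/
noncomputable def dirichletEnergy (u : EuclideanSpace ℝ (Fin n) → ℝ) : ℝ :=
  ∑ i, ∫ x, partialDeriv i u x ^ 2

variable {u : EuclideanSpace ℝ (Fin n) → ℝ}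

lemma dirichletEnergy_nonneg : 0 ≤ dirichletEnergy u :=
  Finset.sum_nonneg fun _ _ => integral_nonneg fun _ => sq_nonneg _

lemma integrable_of_contDiff (hu : ContDiff ℝ ∞ u) (hc : HasCompactSupport u) : Integrable u :=
  hu.continuous.integrable_of_hasCompactSupport hc

lemma integrable_sq_of_contDiff (hu : ContDiff ℝ ∞ u) (hc : HasCompactSupport u) :
    Integrable fun x => u x ^ 2 := by
  simp only [pow_two]
  exact (hu.continuous.mul hu.continuous).integrable_of_hasCompactSupport hc.mul_right

lemma lintegral_translate_sub_sq_le_dirichletEnergy (hu : ContDiff ℝ ∞ u)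
    (hc : HasCompactSupport u) {z : EuclideanSpace ℝ (Fin n)} (hz : z ∈ differenceCube n h) :
    ∫⁻ x, ENNReal.ofReal ((u (x + z) - u x) ^ 2)
      ≤ ENNReal.ofReal (n * h ^ 2 * dirichletEnergy u) := by
  have hi : ∀ i ∈ Finset.univ, Integrable fun x => partialDeriv i u x ^ 2 := fun i _ =>
    integrable_sq_of_contDiff (contDiff_partialDeriv hu) (hasCompactSupport_partialDeriv hc)
  calc ∫⁻ x, ENNReal.ofReal ((u (x + z) - u x) ^ 2)
      ≤ ∫⁻ x, ENNReal.ofReal (fderiv ℝ u x z ^ 2) :=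
        lintegral_translate_sub_sq_le volume (hu.of_le (by simp)) z
    _ ≤ ∫⁻ x, ENNReal.ofReal (n * h ^ 2 * ∑ i, partialDeriv i u x ^ 2) :=
        lintegral_mono fun x => ENNReal.ofReal_le_ofReal (fderiv_apply_sq_le u x hz)
    _ = ENNReal.ofReal (n * h ^ 2 * dirichletEnergy u) := by
        rw [← ofReal_integral_eq_lintegral_ofReal ((integrable_finsetSum _ hi).const_mul _)
          (.of_forall fun x => by positivity), integral_const_mul, integral_finsetSum _ hi]
        rfl

lemma sum_setLIntegral_cube_sub_sq_le (hh : 0 < h) (hu : ContDiff ℝ ∞ u)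
    (hc : HasCompactSupport u) (s : Finset (Fin n → ℤ)) :
    ∑ k ∈ s, ∫⁻ x in cube h k, ∫⁻ y in cube h k, ENNReal.ofReal ((u x - u y) ^ 2)
      ≤ ENNReal.ofReal (n * h ^ 2 * dirichletEnergy u * (2 * h) ^ n) := by
  have hm : Continuous fun p : EuclideanSpace ℝ (Fin n) × EuclideanSpace ℝ (Fin n) =>
      ENNReal.ofReal ((u (p.1 + p.2) - u p.1) ^ 2) := by
    have := hu.continuous
    exact ENNReal.continuous_ofReal.comp (by fun_prop)
  calc ∑ k ∈ s, ∫⁻ x in cube h k, ∫⁻ y in cube h k, ENNReal.ofReal ((u x - u y) ^ 2)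
      ≤ ∑ k ∈ s, ∫⁻ x in cube h k, ∫⁻ z in differenceCube n h,
          ENNReal.ofReal ((u (x + z) - u x) ^ 2) :=
        Finset.sum_le_sum fun k _ => setLIntegral_mono' (measurableSet_cube hh k)
          fun x hx => setLIntegral_cube_sub_sq_le hh u hx
    _ = ∫⁻ x in ⋃ k ∈ s, cube h k, ∫⁻ z in differenceCube n h,
          ENNReal.ofReal ((u (x + z) - u x) ^ 2) :=
        (lintegral_biUnion_finset (pairwiseDisjoint_cube _)
          (fun k _ => measurableSet_cube hh k) _).symm
    _ ≤ ∫⁻ x, ∫⁻ z in differenceCube n h, ENNReal.ofReal ((u (x + z) - u x) ^ 2) :=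
        setLIntegral_le_lintegral _ _
    _ = ∫⁻ z in differenceCube n h, ∫⁻ x, ENNReal.ofReal ((u (x + z) - u x) ^ 2) :=
        lintegral_lintegral_swap (f := fun x z => ENNReal.ofReal ((u (x + z) - u x) ^ 2))
          hm.measurable.aemeasurable
    _ ≤ ∫⁻ _z in differenceCube n h, ENNReal.ofReal (n * h ^ 2 * dirichletEnergy u) :=
        setLIntegral_mono' measurableSet_differenceCube
          fun z hz => lintegral_translate_sub_sq_le_dirichletEnergy hu hc hz
    _ = ENNReal.ofReal (n * h ^ 2 * dirichletEnergy u * (2 * h) ^ n) := by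
        have := dirichletEnergy_nonneg (u := u)
        rw [setLIntegral_const, volume_differenceCube hh, ← ENNReal.ofReal_mul (by positivity)]

lemma isFiniteMeasure_restrict_cube (hh : 0 < h) (k : Fin n → ℤ) :
    IsFiniteMeasure (volume.restrict (cube h k)) :=
  isFiniteMeasure_restrict.2 (by rw [volume_cube hh]; exact ENNReal.ofReal_ne_top)

lemma measureReal_restrict_cube (hh : 0 < h) (k : Fin n → ℤ) :
    (volume.restrict (cube h k)).real Set.univ = h ^ n := by
  rw [measureReal_restrict_apply_univ, measureReal_def, volume_cube hh,
    ENNReal.toReal_ofReal (by positivity)]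

lemma sq_setIntegral_cube_le (hh : 0 < h) (hu : ContDiff ℝ ∞ u) (hc : HasCompactSupport u)
    (k : Fin n → ℤ) : (∫ x in cube h k, u x) ^ 2 ≤ h ^ n * ∫ x in cube h k, u x ^ 2 := by
  have := isFiniteMeasure_restrict_cube hh k
  rw [← measureReal_restrict_cube hh k]
  exact sq_integral_le (integrable_of_contDiff hu hc).restrict
    (integrable_sq_of_contDiff hu hc).restrict

/-- A Poincaré inequality: up to a multiple of `h² ∫ |∇u|²`, the `L²` norm of `u` is controlled by
the integrals of `u` over cubes of side `h` covering its support. -/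
lemma integral_sq_le_sum_cube (hh : 0 < h) (hu : ContDiff ℝ ∞ u) (hc : HasCompactSupport u)
    {s : Finset (Fin n → ℤ)} (hs : Function.support u ⊆ ⋃ k ∈ s, cube h k) :
    ∫ x, u x ^ 2 ≤ (h ^ n)⁻¹ * ∑ k ∈ s, (∫ x in cube h k, u x) ^ 2
      + 2 ^ n * n * h ^ 2 * dirichletEnergy u := by
  have hi := integrable_of_contDiff hu hc
  have hi2 := integrable_sq_of_contDiff hu hc
  have hsum : ∫ x, u x ^ 2 = ∑ k ∈ s, ∫ x in cube h k, u x ^ 2 := by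
    rw [← integral_biUnion_finset s (fun k _ => measurableSet_cube hh k)
      (pairwiseDisjoint_cube _) fun k _ => hi2.integrableOn]
    refine (setIntegral_eq_integral_of_forall_compl_eq_zero fun x hx => ?_).symm
    have : u x = 0 := by
      by_contra h0
      exact hx (hs h0)
    simp [this]
  have hle := sum_setLIntegral_cube_sub_sq_le hh hu hc s
  have hk : ∀ k ∈ s, ∫⁻ x in cube h k, ∫⁻ y in cube h k, ENNReal.ofReal ((u x - u y) ^ 2)
      = ENNReal.ofReal (2 * (h ^ n * (∫ x in cube h k, u x ^ 2)
        - (∫ x in cube h k, u x) ^ 2)) := fun k _ => by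
    have := isFiniteMeasure_restrict_cube hh k
    rw [lintegral_lintegral_sub_sq hi.restrict hi2.restrict, measureReal_restrict_cube hh]
  have h0 := dirichletEnergy_nonneg (u := u)
  -- `ENNReal.ofReal` commutes with the sum only for nonnegative terms; Cauchy–Schwarz on each cube
  -- provides this.
  rw [Finset.sum_congr rfl hk, ← ENNReal.ofReal_sum_of_nonneg fun k _ => by
      have := sq_setIntegral_cube_le hh hu hc k
      linarith,
    ENNReal.ofReal_le_ofReal_iff (by positivity), ← Finset.mul_sum, Finset.sum_sub_distrib,
    ← Finset.mul_sum, ← hsum] at hle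
  have hV : 0 < h ^ n := by positivity
  refine le_of_mul_le_mul_left ?_ hV
  rw [mul_add, mul_inv_cancel_left₀ hV.ne']
  have h1 : n * h ^ 2 * dirichletEnergy u * (2 * h) ^ n
      = h ^ n * (2 ^ n * n * h ^ 2 * dirichletEnergy u) := by
    rw [mul_pow]
    ring
  -- The variance identity carries a factor `2`, so half of the energy term would suffice; its
  -- nonnegativity allows the other half to be added.
  have h2 : 0 ≤ h ^ n * (2 ^ n * n * h ^ 2 * dirichletEnergy u) := by positivity
  linarith

/-! ### Comparison with the Sobolev inner product -/

lemma multiDeriv_zero (u : EuclideanSpace ℝ (Fin n) → ℝ) : multiDeriv 0 u = u := by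
  simp [multiDeriv]

lemma multiDeriv_single (i : Fin n) (u : EuclideanSpace ℝ (Fin n) → ℝ) :
    multiDeriv (Pi.single i 1) u = partialDeriv i u := by
  -- Generalized to lists without repetition for the induction: the derivative is applied exactly
  -- once if `i` occurs, and otherwise not at all.
  have key : ∀ l : List (Fin n), l.Nodup →
      l.foldr (fun j g => (partialDeriv j)^[(Pi.single i 1 : Fin n → ℕ) j] g) u
        = if i ∈ l then partialDeriv i u else u := by
    intro l hl
    induction l with
    | nil => simp
    | cons j l ih =>
      rw [List.nodup_cons] at hl
      rw [List.foldr_cons, ih hl.2]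
      by_cases hij : i = j
      · subst hij
        simp [hl.1]
      · simp [hij]
  simpa [multiDeriv] using key _ (List.nodup_finRange n)

lemma integral_multiDeriv_sq_le_euclideanSobolevInner {k : ℕ} {I : Fin n → ℕ}
    (hI : ∑ i, I i ≤ k) : ∫ x, multiDeriv I u x ^ 2 ≤ euclideanSobolevInner k u u := by
  have h0 : ∀ I : Fin n → ℕ, 0 ≤ ∫ x, multiDeriv I u x * multiDeriv I u x :=
    fun I => integral_nonneg fun _ => mul_self_nonneg _
  simp only [pow_two]
  calc ∫ x, multiDeriv I u x * multiDeriv I u x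
      ≤ ∑ J ∈ Finset.piAntidiag Finset.univ (∑ i, I i),
          ∫ x, multiDeriv J u x * multiDeriv J u x :=
        Finset.single_le_sum (f := fun J => ∫ x, multiDeriv J u x * multiDeriv J u x)
          (fun J _ => h0 J) (by simp)
    _ ≤ euclideanSobolevInner k u u :=
        Finset.single_le_sum (f := fun j => ∑ J ∈ Finset.piAntidiag Finset.univ j,
          ∫ x, multiDeriv J u x * multiDeriv J u x)
          (fun j _ => Finset.sum_nonneg fun J _ => h0 J) (by simpa [Nat.lt_succ_iff] using hI)

lemma integral_sq_le_euclideanSobolevInner (k : ℕ) :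
    ∫ x, u x ^ 2 ≤ euclideanSobolevInner k u u := by
  have h := integral_multiDeriv_sq_le_euclideanSobolevInner (u := u) (k := k) (I := 0) (by simp)
  rwa [multiDeriv_zero] at h

lemma euclideanSobolevInner_zero : euclideanSobolevInner 0 u u = ∫ x, u x ^ 2 := by
  simp [euclideanSobolevInner, multiDeriv_zero, pow_two]

lemma dirichletEnergy_le_euclideanSobolevInner {k : ℕ} (hk : 1 ≤ k) :
    dirichletEnergy u ≤ n * euclideanSobolevInner k u u := by
  have h : ∀ i ∈ Finset.univ, ∫ x, partialDeriv i u x ^ 2 ≤ euclideanSobolevInner k u u :=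
    fun i _ => by
      rw [← multiDeriv_single]
      exact integral_multiDeriv_sq_le_euclideanSobolevInner (by simpa using hk)
  simpa [dirichletEnergy] using Finset.sum_le_card_nsmul _ _ _ h

/-! ### Transfer to the manifold and its Sobolev spaces -/

variable {ι : Type*} {M : Type*} [TopologicalSpace M]
  [ChartedSpace (EuclideanSpace ℝ (Fin n)) M]

namespace SobolevCover

/-- A compact set that contains the supports of all the localizations of functions on `M`. -/
def compactSupport (D : SobolevCover ι n M) : Set (EuclideanSpace ℝ (Fin n)) :=
  ⋃ i, D.chart i '' tsupport (D.ρ i)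

lemma isCompact_compactSupport [CompactSpace M] [Finite ι] (D : SobolevCover ι n M) :
    IsCompact D.compactSupport :=
  isCompact_iUnion fun i => (isClosed_tsupport _).isCompact.image_of_continuousOn
    ((D.chart i).continuousOn.mono (D.subordinate i))

lemma support_localize_subset (D : SobolevCover ι n M) (i : ι) (f : M → ℝ) :
    Function.support (D.localize i f) ⊆ D.compactSupport := by
  intro x hx
  refine Set.mem_iUnion.2 ⟨i, (D.chart i).symm x, ?_,
    (D.chart i).right_inv (by rw [D.chart_target i]; trivial)⟩
  by_contra h
  exact hx (by simp [localize, image_eq_zero_of_notMem_tsupport h])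

variable [CompactSpace M] [Fintype ι] (D : SobolevCover ι n M)

lemma integral_localize_sq_le {k : ℕ} (i : ι) (f : SmoothFun D k) :
    ∫ x, D.localize i f.toFun x ^ 2 ≤ ‖f‖ ^ 2 := by
  rw [norm_sq_smoothFun]
  refine (integral_sq_le_euclideanSobolevInner k).trans ?_
  exact Finset.single_le_sum (f := fun i =>
    euclideanSobolevInner k (D.localize i f.toFun) (D.localize i f.toFun))
    (fun i _ => euclideanSobolevInner_self_nonneg k _) (Finset.mem_univ i)

/-- The integral of the localization of a smooth function over a cube of side `h`. -/
noncomputable def cubeIntegral {h : ℝ} (hh : 0 < h) (k : ℕ) (i : ι) (c : Fin n → ℤ) :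
    SmoothFun D k →L[ℝ] ℝ :=
  LinearMap.mkContinuous
    { toFun := fun f => ∫ x in cube h c, D.localize i f.toFun x
      map_add' := fun f g => by
        have hl : D.localize i (f + g).toFun = D.localize i f.toFun + D.localize i g.toFun :=
          funext fun x => mul_add _ _ _
        have hi : ∀ f : SmoothFun D k, IntegrableOn (D.localize i f.toFun) (cube h c) := fun f =>
          (integrable_of_contDiff (D.contDiff_localize i f.contMDiff)
            (D.hasCompactSupport_localize i _)).integrableOn
        rw [hl]
        exact integral_add (hi f) (hi g)
      map_smul' := fun a f => by
        have hl : D.localize i (a • f).toFun = a • D.localize i f.toFun :=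
          funext fun x => mul_left_comm _ _ _
        rw [hl]
        -- The operator bound `√(h ^ n)` is Cauchy–Schwarz on a cube of volume `h ^ n`.
        exact integral_const_mul _ _ } (√(h ^ n)) fun f => by
    have hu := D.contDiff_localize i f.contMDiff
    have hc := D.hasCompactSupport_localize i f.toFun
    have h0 : (0 : ℝ) ≤ h ^ n := by positivity
    refine abs_le_of_sq_le_sq ?_ (by positivity)
    rw [mul_pow, Real.sq_sqrt h0]
    refine (sq_setIntegral_cube_le hh hu hc c).trans (mul_le_mul_of_nonneg_left ?_ h0)
    exact (setIntegral_le_integral (integrable_sq_of_contDiff hu hc)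
      (.of_forall fun x => sq_nonneg _)).trans (D.integral_localize_sq_le i f)

/-- The Poincaré inequality is applied in every chart with one common family of cubes. In `n ^ 2`,
one factor comes from `|z|² ≤ n h²`, the other from bounding each of the `n` first partials by the
whole Sobolev inner product. -/
lemma norm_sq_smoothToL2_le {h : ℝ} (hh : 0 < h) {s : Finset (Fin n → ℤ)}
    (hs : D.compactSupport ⊆ ⋃ c ∈ s, cube h c) {k : ℕ} (hk : 1 ≤ k) (f : SmoothFun D k) :
    ‖smoothToL2 D k f‖ ^ 2 ≤ (h ^ n)⁻¹ * ∑ i, ∑ c ∈ s, D.cubeIntegral hh k i c f ^ 2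
      + 2 ^ n * n ^ 2 * h ^ 2 * ‖f‖ ^ 2 := by
  rw [norm_sq_smoothFun, norm_sq_smoothFun, sobolevInner, sobolevInner, Finset.mul_sum,
    Finset.mul_sum, ← Finset.sum_add_distrib]
  refine Finset.sum_le_sum fun i _ => ?_
  rw [euclideanSobolevInner_zero]
  refine (integral_sq_le_sum_cube hh (D.contDiff_localize i f.contMDiff)
    (D.hasCompactSupport_localize i f.toFun)
    ((D.support_localize_subset i _).trans hs)).trans (add_le_add le_rfl ?_)
  refine (mul_le_mul_of_nonneg_left (dirichletEnergy_le_euclideanSobolevInner hk)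
    (by positivity)).trans_eq ?_
  ring

/-- Up to a small multiple of the Sobolev norm, the `L²` norm is controlled by finitely many
continuous functionals. -/
lemma norm_sq_toL2_le {h : ℝ} (hh : 0 < h) {s : Finset (Fin n → ℤ)}
    (hs : D.compactSupport ⊆ ⋃ c ∈ s, cube h c) {k : ℕ} (hk : 1 ≤ k) (f : SobolevSpace D k) :
    ‖toL2 D k f‖ ^ 2 ≤ (h ^ n)⁻¹ * ∑ i, ∑ c ∈ s, (D.cubeIntegral hh k i c).fromCompletion f ^ 2
      + 2 ^ n * n ^ 2 * h ^ 2 * ‖f‖ ^ 2 := by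
  induction f using UniformSpace.Completion.induction_on with
  | hp => exact isClosed_le (by fun_prop) (by fun_prop)
  | ih f =>
    simpa only [toL2, ContinuousLinearMap.completion_apply_coe,
      ContinuousLinearMap.fromCompletion_apply_coe, UniformSpace.Completion.norm_coe]
      using D.norm_sq_smoothToL2_le hh hs hk f

end SobolevCover

end SobolevManifold

/-! ### Finite dimensionality -/

open SobolevManifold in
theorem finiteDimensional_of_norm_le {n : ℕ} {M : Type*} [TopologicalSpace M] [CompactSpace M]
    [ChartedSpace (EuclideanSpace ℝ (Fin n)) M] {ι : Type*} [Fintype ι] (D : SobolevCover ι n M)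
    {k : ℕ} (hk : 1 ≤ k) (S : Submodule ℝ (SobolevSpace D k)) {C : ℝ} (hC : 0 < C)
    (hS : ∀ f ∈ S, ‖f‖ ≤ C * ‖toL2 D k f‖) : FiniteDimensional ℝ S := by
  set a : ℝ := 2 ^ n * n ^ 2 with ha
  have ha0 : 0 ≤ a := by positivity
  obtain ⟨h, hh, hCh⟩ : ∃ h : ℝ, 0 < h ∧ C ^ 2 * (a * h ^ 2) < 1 := by
    -- This `h` makes the product equal to `a / (a + 1)`; using `a + 1` avoids dividing by zero when
    -- `n = 0`.
    refine ⟨(C * √(a + 1))⁻¹, by positivity, ?_⟩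
    rw [inv_pow, mul_pow, Real.sq_sqrt (by positivity)]
    have : C ^ 2 * (a * (C ^ 2 * (a + 1))⁻¹) = a / (a + 1) := by field_simp
    rw [this, div_lt_one (by positivity)]
    linarith
  obtain ⟨s, hs⟩ := exists_finset_cover_cube D.isCompact_compactSupport.isBounded hh
  let Φ : S →ₗ[ℝ] ι → s → ℝ := LinearMap.pi fun i => LinearMap.pi fun c =>
    (D.cubeIntegral hh k i c).fromCompletion.toLinearMap ∘ₗ S.subtype
  refine FiniteDimensional.of_injective Φ ((injective_iff_map_eq_zero Φ).2 fun f hf => ?_)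
  have hz : ∀ i, ∀ c ∈ s, (D.cubeIntegral hh k i c).fromCompletion (f : SobolevSpace D k) = 0 :=
    fun i c hc => congrFun (congrFun hf i) ⟨c, hc⟩
  have h1 := D.norm_sq_toL2_le hh hs hk (f : SobolevSpace D k)
  rw [Finset.sum_eq_zero fun i _ => Finset.sum_eq_zero fun c hc => by
    rw [hz i c hc, zero_pow two_ne_zero], mul_zero, zero_add, ← ha] at h1
  have h2 : ‖(f : SobolevSpace D k)‖ ^ 2 ≤ C ^ 2 * (a * h ^ 2) * ‖(f : SobolevSpace D k)‖ ^ 2 :=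
    calc ‖(f : SobolevSpace D k)‖ ^ 2 ≤ (C * ‖toL2 D k f‖) ^ 2 := by
          gcongr
          exact hS f f.2
      _ = C ^ 2 * ‖toL2 D k f‖ ^ 2 := mul_pow _ _ _
      _ ≤ C ^ 2 * (a * h ^ 2 * ‖(f : SobolevSpace D k)‖ ^ 2) := by gcongr
      _ = _ := by ring
  -- The coefficient in `h2` is below one by the choice of `h`, so the norm term can be absorbed on
  -- the left.
  have h3 : ‖(f : SobolevSpace D k)‖ ^ 2 ≤ 0 := by
    nlinarith [sq_nonneg ‖(f : SobolevSpace D k)‖]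
  have h4 : ‖(f : SobolevSpace D k)‖ = 0 := pow_eq_zero_iff two_ne_zero |>.1
    (le_antisymm h3 (sq_nonneg _))
  exact Subtype.ext (norm_eq_zero.1 h4)

theorem lemma1p2 {n : ℕ} {M : Type*} [TopologicalSpace M] [T2Space M] [CompactSpace M]
    [ChartedSpace (EuclideanSpace ℝ (Fin n)) M] [IsManifold (𝓡 n) ∞ M]
    {ι : Type*} [Fintype ι] (D : SobolevManifold.SobolevCover ι n M)
    (S : Submodule ℝ (SobolevManifold.SobolevSpace D 2))
    (hS : ∃ C : ℝ, 0 < C ∧ ∀ f ∈ S, ‖f‖ ≤ C * ‖SobolevManifold.toL2 D 2 f‖) :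
    FiniteDimensional ℝ S := by
  obtain ⟨C, hC, hS⟩ := hS
  exact finiteDimensional_of_norm_le D one_le_two S hC hS
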